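/- Let $(X,\Sigma)$ be an arbitrary measurable space ($\Sigma$ a $\sigma$-algebra) and let $p(x,E)$, $x\in X$, $E\in\Sigma$, be a Markov transition function: $p(x,\cdot)$ is a countably additive probability measure on $\Sigma$ for every $x\in X$, and $p(\cdot,E)$ is $\Sigma$-measurable for every $E\in\Sigma$. Let $p^k$ denote the $k$-step transition function. Let $ba(X,\Sigma)$ be the space of bounded finitely additive set functions $\mu:\Sigma\to\mathbb R$, and let $A=T^*: ba(X,\Sigma)\to ba(X,\Sigma)$ be the Markov operator $$(A\mu)(E)=\int_X p(x,E)\,\mu(dx),\qquad E\in\Sigma,$$ where the integral of a bounded measurable function with respect to $\mu$ is the limit of the integrals of simple functions converging to it uniformly. Let $\Delta_{ba}$ be the set of all $\mu\in ba(X,\Sigma)$ with $\mu\ge 0$, $\mu(X)=1$ and $A\mu=\mu$. A nonnegative $\mu\in ba(X,\Sigma)$ is called purely finitely additive if every countably additive $\nu$ with $0\le\nu\le\mu$ is identically zero. Theorem 4.4. The following conditions are equivalent: - $(D)$ (Doeblin's condition) there exist a finite countably additive measure $\varphi\ge 0$ on $\Sigma$, a number $\varepsilon>0$ and an integer $k\ge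 1$ such that for every $E\in\Sigma$ with $\varphi(E)\le\varepsilon$ one has $p^k(x,E)\le 1-\varepsilon$ for all $x\in X$; - $(*)$ every $\mu\in\Delta_{ba}$ is countably additive; - no $\mu\in\Delta_{ba}$ is purely finitely additive. -/

import Mathlib

open Filter MeasureTheory ProbabilityTheory Topology

/-- An element of `ba(X, Σ)`: a bounded finitely additive real set function on the σ-algebra of `X`.
As for `MeasureTheory.VectorMeasure`, the value on non-measurable sets is set to `0`, so that two
charges are equal iff they agree on all measurable sets. -/
structure Charge (X : Type*) [MeasurableSpace X] where
  toFun : Set X → ℝ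
  not_measurable' : ∀ E, ¬ MeasurableSet E → toFun E = 0
  empty' : toFun ∅ = 0
  union' : ∀ E F, MeasurableSet E → MeasurableSet F → Disjoint E F →
    toFun (E ∪ F) = toFun E + toFun F
  bounded' : ∃ C : ℝ, ∀ E, MeasurableSet E → |toFun E| ≤ C

namespace Charge

variable {X : Type*} [MeasurableSpace X]

instance : CoeFun (Charge X) (fun _ => Set X → ℝ) := ⟨Charge.toFun⟩

/-- `μ ∈ ca(X, Σ)`. -/
def IsCountablyAdditive (μ : Charge X) : Prop :=
  ∀ E : ℕ → Set X, (∀ n, MeasurableSet (E n)) → Pairwise (fun i j => Disjoint (E i) (E j)) →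
    HasSum (fun n => μ (E n)) (μ (⋃ n, E n))

/-- `μ ≥ 0`. -/
def IsNonneg (μ : Charge X) : Prop := ∀ E, MeasurableSet E → 0 ≤ μ E

/-- `μ ∈ S_ba`: nonnegative and normalized (the total variation norm of a nonnegative charge `μ`
is `μ X`). -/
def IsProbability (μ : Charge X) : Prop := μ.IsNonneg ∧ μ Set.univ = 1

/-- A nonnegative charge is purely finitely additive if the only countably additive measure `ν`
with `0 ≤ ν ≤ μ` is zero. -/
def IsNonnegPurelyFinitelyAdditive (μ : Charge X) : Prop :=
  μ.IsNonneg ∧ ∀ ν : Charge X, ν.IsCountablyAdditive → ν.IsNonneg →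
    (∀ E, MeasurableSet E → ν E ≤ μ E) → ∀ E, MeasurableSet E → ν E = 0

/-- The integral of a simple function with respect to a charge. -/
noncomputable def simpleIntegral (μ : Charge X) (g : SimpleFunc X ℝ) : ℝ :=
  ∑ y ∈ g.range, y * μ (g ⁻¹' {y})

/-- The filter of simple functions converging uniformly to `f`. -/
def uniformApprox (f : X → ℝ) : Filter (SimpleFunc X ℝ) :=
  ⨅ (ε : ℝ) (_ : 0 < ε), 𝓟 {g | ∀ x, |g x - f x| ≤ ε}

/-- The integral of a bounded measurable function with respect to a charge: the limit of the
integrals of simple functions converging uniformly to `f`. The limit exists for every bounded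
measurable `f`, see `Charge.tendsto_integral`. -/
noncomputable def integral (μ : Charge X) (f : X → ℝ) : ℝ :=
  limUnder (uniformApprox f) μ.simpleIntegral

theorem hasBasis_uniformApprox (f : X → ℝ) :
    (uniformApprox f).HasBasis (fun ε : ℝ => 0 < ε) (fun ε => {g | ∀ x, |g x - f x| ≤ ε}) := by
  unfold uniformApprox
  refine hasBasis_biInf_principal' (p := fun ε : ℝ => 0 < ε) ?_ ⟨1, one_pos⟩
  intro a ha b hb
  refine ⟨min a b, lt_min ha hb, ?_, ?_⟩
  · intro g hg x; exact (hg x).trans (min_le_left _ _)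
  · intro g hg x; exact (hg x).trans (min_le_right _ _)

theorem exists_simple_approx {f : X → ℝ} (hf : Measurable f) {C : ℝ} (hC : ∀ x, |f x| ≤ C)
    {ε : ℝ} (hε : 0 < ε) : ∃ g : SimpleFunc X ℝ, ∀ x, |g x - f x| ≤ ε := by
  have hm : Measurable (fun x => ε * (⌊f x / ε⌋ : ℝ)) := by fun_prop
  have hfin : (Set.range (fun x => ε * (⌊f x / ε⌋ : ℝ))).Finite := by
    refine ((Set.finite_Icc ⌊-C / ε⌋ ⌊C / ε⌋).image (fun n : ℤ => ε * (n : ℝ))).subset ?_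
    rintro _ ⟨x, rfl⟩
    refine ⟨⌊f x / ε⌋, ⟨Int.floor_le_floor ?_, Int.floor_le_floor ?_⟩, rfl⟩
    · exact div_le_div_of_nonneg_right (abs_le.1 (hC x)).1 hε.le
    · exact div_le_div_of_nonneg_right (abs_le.1 (hC x)).2 hε.le
  refine ⟨⟨fun x => ε * (⌊f x / ε⌋ : ℝ), fun y => hm (measurableSet_singleton y), hfin⟩, ?_⟩
  intro x
  have h1 := Int.floor_le (f x / ε)
  have h2 := Int.lt_floor_add_one (f x / ε)
  rw [le_div_iff₀ hε] at h1
  rw [div_lt_iff₀ hε] at h2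
  change |ε * (⌊f x / ε⌋ : ℝ) - f x| ≤ ε
  rw [abs_le]
  constructor <;> nlinarith

theorem neBot_uniformApprox {f : X → ℝ} (hf : Measurable f) {C : ℝ} (hC : ∀ x, |f x| ≤ C) :
    (uniformApprox f).NeBot :=
  (hasBasis_uniformApprox f).neBot_iff.2 fun hε => exists_simple_approx hf hC hε

theorem simpleIntegral_eq (μ : Charge X) (g : SimpleFunc X ℝ) :
    μ.simpleIntegral g =
      SimpleFunc.setToSimpleFunc (fun E => μ E • ContinuousLinearMap.id ℝ ℝ) g := by
  unfold simpleIntegral SimpleFunc.setToSimpleFunc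
  refine Finset.sum_congr rfl fun y _ => ?_
  simp [mul_comm]

theorem finMeasAdditive (μ : Charge X) :
    FinMeasAdditive (0 : Measure X) (fun E => μ E • ContinuousLinearMap.id ℝ ℝ) := by
  intro s t hs ht _ _ hd
  simp only
  rw [μ.union' s t hs ht hd, add_smul]

theorem simpleIntegral_add (μ : Charge X) (g h : SimpleFunc X ℝ) :
    μ.simpleIntegral (g + h) = μ.simpleIntegral g + μ.simpleIntegral h := by
  simp only [simpleIntegral_eq]
  exact SimpleFunc.setToSimpleFunc_add _ μ.finMeasAdditive (by simp) (by simp)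

theorem simpleIntegral_sub (μ : Charge X) (g h : SimpleFunc X ℝ) :
    μ.simpleIntegral (g - h) = μ.simpleIntegral g - μ.simpleIntegral h := by
  have := μ.simpleIntegral_add (g - h) h
  rw [sub_add_cancel] at this
  linarith

theorem sum_preimage (μ : Charge X) (g : SimpleFunc X ℝ) (s : Finset ℝ) :
    ∑ y ∈ s, μ (g ⁻¹' {y}) = μ (g ⁻¹' (s : Set ℝ)) := by
  classical
  induction s using Finset.induction_on with
  | empty => simp [μ.empty']
  | insert a s ha ih =>
    rw [Finset.sum_insert ha, ih, Finset.coe_insert, Set.insert_eq, Set.preimage_union]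
    refine (μ.union' _ _ (g.measurableSet_preimage _) (g.measurableSet_preimage _) ?_).symm
    refine Disjoint.preimage _ ?_
    simpa using ha

theorem abs_simpleIntegral_le (μ : Charge X) {C : ℝ} (hC : ∀ E, MeasurableSet E → |μ E| ≤ C)
    (g : SimpleFunc X ℝ) {ε : ℝ} (hε : 0 ≤ ε) (hg : ∀ x, |g x| ≤ ε) :
    |μ.simpleIntegral g| ≤ ε * (2 * C) := by
  classical
  have h1 : |μ.simpleIntegral g| ≤ ∑ y ∈ g.range, ε * |μ (g ⁻¹' {y})| := by
    refine (Finset.abs_sum_le_sum_abs _ _).trans (Finset.sum_le_sum fun y hy => ?_)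
    rw [abs_mul]
    obtain ⟨x, rfl⟩ := SimpleFunc.mem_range.1 hy
    exact mul_le_mul_of_nonneg_right (hg x) (abs_nonneg _)
  refine h1.trans ?_
  rw [← Finset.mul_sum]
  refine mul_le_mul_of_nonneg_left ?_ hε
  rw [← Finset.sum_filter_add_sum_filter_not g.range (fun y => 0 ≤ μ (g ⁻¹' {y}))]
  have hp : ∑ y ∈ g.range with 0 ≤ μ (g ⁻¹' {y}), |μ (g ⁻¹' {y})| ≤ C := by
    rw [Finset.sum_congr rfl fun y hy => abs_of_nonneg (Finset.mem_filter.1 hy).2, sum_preimage]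
    exact (le_abs_self _).trans (hC _ (g.measurableSet_preimage _))
  have hn : ∑ y ∈ g.range with ¬ 0 ≤ μ (g ⁻¹' {y}), |μ (g ⁻¹' {y})| ≤ C := by
    rw [Finset.sum_congr rfl fun y hy =>
      abs_of_nonpos (not_le.1 (Finset.mem_filter.1 hy).2).le, Finset.sum_neg_distrib, sum_preimage]
    exact (neg_le_abs _).trans (hC _ (g.measurableSet_preimage _))
  linarith

/-- The limit that defines the integral exists for bounded measurable functions. -/
theorem tendsto_integral (μ : Charge X) {f : X → ℝ} (hf : Measurable f) {C : ℝ}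
    (hC : ∀ x, |f x| ≤ C) :
    Tendsto μ.simpleIntegral (uniformApprox f) (𝓝 (μ.integral f)) := by
  have := neBot_uniformApprox hf hC
  obtain ⟨D, hD⟩ := μ.bounded'
  have hD0 : 0 ≤ D := (abs_nonneg _).trans (hD ∅ MeasurableSet.empty)
  have hcauchy : Cauchy (Filter.map μ.simpleIntegral (uniformApprox f)) := by
    rw [Metric.cauchy_iff]
    refine ⟨inferInstance, fun ε hε => ?_⟩
    set δ : ℝ := ε / (4 * D + 1) / 2 with hδ
    have hδ0 : 0 < δ := by positivity
    refine ⟨_, image_mem_map ((hasBasis_uniformApprox f).mem_of_mem hδ0), ?_⟩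
    rintro _ ⟨g, hg, rfl⟩ _ ⟨h, hh, rfl⟩
    rw [Real.dist_eq, ← simpleIntegral_sub]
    have hgh : ∀ x, |(g - h) x| ≤ 2 * δ := by
      intro x
      rw [SimpleFunc.coe_sub, Pi.sub_apply]
      have e1 := abs_le.1 (hg x)
      have e2 := abs_le.1 (hh x)
      rw [abs_le]
      constructor <;> linarith [e1.1, e1.2, e2.1, e2.2]
    refine (μ.abs_simpleIntegral_le hD (g - h) (by positivity) hgh).trans_lt ?_
    have : 2 * δ * (4 * D + 1) = ε := by
      rw [hδ]; field_simp
    nlinarith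
  exact tendsto_nhds_limUnder (CompleteSpace.complete hcauchy)

theorem integral_add (μ : Charge X) {f₁ f₂ : X → ℝ} (h₁ : Measurable f₁) (h₂ : Measurable f₂)
    {C₁ C₂ : ℝ} (hC₁ : ∀ x, |f₁ x| ≤ C₁) (hC₂ : ∀ x, |f₂ x| ≤ C₂) :
    μ.integral (fun x => f₁ x + f₂ x) = μ.integral f₁ + μ.integral f₂ := by
  have := neBot_uniformApprox h₁ hC₁
  have := neBot_uniformApprox h₂ hC₂
  have hsum : Tendsto (fun p : SimpleFunc X ℝ × SimpleFunc X ℝ => p.1 + p.2)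
      (uniformApprox f₁ ×ˢ uniformApprox f₂) (uniformApprox (fun x => f₁ x + f₂ x)) := by
    refine (hasBasis_uniformApprox _).tendsto_right_iff.2 fun ε hε => ?_
    have m₁ := (hasBasis_uniformApprox f₁).mem_of_mem (half_pos hε)
    have m₂ := (hasBasis_uniformApprox f₂).mem_of_mem (half_pos hε)
    filter_upwards [prod_mem_prod m₁ m₂] with p hp
    intro x
    have e1 := abs_le.1 (hp.1 x)
    have e2 := abs_le.1 (hp.2 x)
    rw [SimpleFunc.coe_add, Pi.add_apply, abs_le]
    constructor <;> linarith [e1.1, e1.2, e2.1, e2.2]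
  have hC : ∀ x, |f₁ x + f₂ x| ≤ C₁ + C₂ := fun x =>
    (abs_add_le _ _).trans (add_le_add (hC₁ x) (hC₂ x))
  have t := (μ.tendsto_integral (h₁.add h₂) hC).comp hsum
  have t' := ((μ.tendsto_integral h₁ hC₁).comp tendsto_fst).add
    ((μ.tendsto_integral h₂ hC₂).comp (tendsto_snd (f := uniformApprox f₁)))
  refine tendsto_nhds_unique t (t'.congr fun p => ?_)
  exact (μ.simpleIntegral_add p.1 p.2).symm

theorem abs_integral_le (μ : Charge X) {C : ℝ} (hC : ∀ E, MeasurableSet E → |μ E| ≤ C)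
    {f : X → ℝ} (hf : Measurable f) {B : ℝ} (hB0 : 0 ≤ B) (hB : ∀ x, |f x| ≤ B) :
    |μ.integral f| ≤ (B + 1) * (2 * C) := by
  have := neBot_uniformApprox hf hB
  refine le_of_tendsto (μ.tendsto_integral hf hB).abs ?_
  filter_upwards [(hasBasis_uniformApprox f).mem_of_mem one_pos] with g hg
  refine μ.abs_simpleIntegral_le hC g (by positivity) fun x => ?_
  have e1 := abs_le.1 (hg x)
  have e2 := abs_le.1 (hB x)
  rw [abs_le]
  constructor <;> linarith [e1.1, e1.2, e2.1, e2.2]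

theorem abs_kernel_real_le (κ : Kernel X X) [IsMarkovKernel κ] (E : Set X) (x : X) :
    |(κ x).real E| ≤ 1 := by
  rw [abs_of_nonneg measureReal_nonneg]
  exact measureReal_le_one

theorem measurable_kernel_real (κ : Kernel X X) {E : Set X} (hE : MeasurableSet E) :
    Measurable (fun x => (κ x).real E) :=
  (κ.measurable_coe hE).ennreal_toReal

open Classical in
/-- The Markov operator `A = T*` on `ba(X, Σ)` of the chain with transition function `κ`:
`(A μ)(E) = ∫ κ(x, E) μ(dx)`. -/
noncomputable def markovOperator (κ : Kernel X X) [IsMarkovKernel κ] (μ : Charge X) :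
    Charge X where
  toFun E := if MeasurableSet E then μ.integral (fun x => (κ x).real E) else 0
  not_measurable' E hE := by simp [hE]
  empty' := by
    have h := μ.integral_add (f₁ := fun _ => 0) (f₂ := fun _ => 0) (C₁ := 0) (C₂ := 0)
      measurable_const measurable_const (by simp) (by simp)
    simp only [add_zero] at h
    simp only [MeasurableSet.empty, if_true, measureReal_empty]
    linarith
  union' E F hE hF hd := by
    rw [if_pos hE, if_pos hF, if_pos (hE.union hF), ← μ.integral_add
      (measurable_kernel_real κ hE) (measurable_kernel_real κ hF)
      (abs_kernel_real_le κ E) (abs_kernel_real_le κ F)]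
    congr 1
    funext x
    exact measureReal_union hd hF
  bounded' := by
    obtain ⟨C, hC⟩ := μ.bounded'
    refine ⟨(1 + 1) * (2 * C), fun E hE => ?_⟩
    rw [if_pos hE]
    exact μ.abs_integral_le hC (measurable_kernel_real κ hE) zero_le_one (abs_kernel_real_le κ E)

end Charge

/-- `Δ_ba`: the invariant finitely additive probability measures of the chain. -/
def invariantCharges {X : Type*} [MeasurableSpace X] (κ : Kernel X X) [IsMarkovKernel κ] :
    Set (Charge X) :=
  {μ | μ.IsProbability ∧ μ.markovOperator κ = μ}

/-- The Doeblin condition `(D)`. Here `κ ^ k` is the `k`-th iterate of the transition function. -/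
def DoeblinCondition {X : Type*} [MeasurableSpace X] (κ : Kernel X X) : Prop :=
  ∃ φ : Measure X, IsFiniteMeasure φ ∧ ∃ ε : ℝ, 0 < ε ∧ ∃ k : ℕ, 1 ≤ k ∧
    ∀ E, MeasurableSet E → φ.real E ≤ ε → ∀ x, ((κ ^ k) x).real E ≤ 1 - ε

/-! The conditions are linked in a cycle: `(D)` excludes purely finitely additive invariant charges,
their absence gives `(*)`, and `(*)` gives `(D)`.

A purely finitely additive `μ` nearly lives on sets `E` of tiny `φ`-measure
(`exists_measure_compl_le`). If `μ` is also invariant, `(D)` gives `μ E = ∫ p^k(x, E) μ(dx) ≤ 1 -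
ε`, which contradicts `μ E` being close to `1`.

If an invariant `μ` is not countably additive, its greatest countably additive minorant is invariant
too (`bind_countablyAdditivePart`), so the normalized remainder is invariant and purely finitely
additive.

Under `(*)`, ultrafilter limits of asymptotically invariant probability measures are genuine
invariant measures (`exists_invariant_measure_tendsto`). This rules out infinite mutually singular
families of invariant probabilities, hence one invariant `φ` dominates them all
(`exists_invariant_dominating`). If `(D)` failed for this `φ`, there would be `φ`-small sets `E k`
reached from points `x k` at time `k + 1` with probability near `1`. Time averages may miss `E k`,
so it is enlarged to the set `G k` of points likely to hit it: `G k` is still `φ`-small, yet nearly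
full for the Cesàro mean started at `x k`. A limit `P` of these means gives full mass to `limsup G`,
which is `φ`-null by Borel–Cantelli, against `P ≪ φ`. -/

namespace Charge

variable {X : Type*} [MeasurableSpace X]

/-! ### Estimates for the integral against a charge. -/

theorem ext_of_measurable {μ ν : Charge X} (h : ∀ E, MeasurableSet E → μ E = ν E) : μ = ν := by
  obtain ⟨f, hf, _, _, _⟩ := μ
  obtain ⟨g, hg, _, _, _⟩ := ν
  have : f = g := by
    funext E
    by_cases hE : MeasurableSet E
    · exact h E hE
    · rw [hf E hE, hg E hE]
  subst this
  rfl

theorem isMarkovKernel_pow (κ : Kernel X X) [IsMarkovKernel κ] (k : ℕ) :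
    IsMarkovKernel (κ ^ k) := by
  induction k with
  | zero => exact inferInstanceAs (IsMarkovKernel Kernel.id)
  | succ k ih => rw [pow_succ]; exact inferInstanceAs (IsMarkovKernel ((κ ^ k) ∘ₖ κ))

theorem eq_of_forall_abs_sub_le {a b K : ℝ} (h : ∀ ε > 0, |a - b| ≤ ε * K) : a = b := by
  have hK : 0 ≤ K := by
    have := (abs_nonneg _).trans (h 1 one_pos)
    linarith
  by_contra hab
  have hpos : 0 < |a - b| := abs_pos.2 (sub_ne_zero.2 hab)
  have h1 := h (|a - b| / (2 * (K + 1))) (by positivity)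
  have h2 : |a - b| / (2 * (K + 1)) * (2 * (K + 1)) = |a - b| := by field_simp
  nlinarith [div_pos hpos (by positivity : 0 < 2 * (K + 1))]

/-- A simple function that is uniformly `ε`-close to `f` has integral close to that of `f`. -/
theorem abs_integral_sub_simpleIntegral_le (μ : Charge X) {D : ℝ}
    (hD : ∀ E, MeasurableSet E → |μ E| ≤ D) {f : X → ℝ} (hf : Measurable f) {C : ℝ}
    (hC : ∀ x, |f x| ≤ C) {ε : ℝ} (hε : 0 < ε) {g : SimpleFunc X ℝ}
    (hg : ∀ x, |g x - f x| ≤ ε) : |μ.integral f - μ.simpleIntegral g| ≤ ε * (4 * D) := by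
  have := neBot_uniformApprox hf hC
  refine le_of_tendsto ((μ.tendsto_integral hf hC).sub_const _).abs ?_
  filter_upwards [(hasBasis_uniformApprox f).mem_of_mem hε] with h hh
  rw [← simpleIntegral_sub]
  refine (μ.abs_simpleIntegral_le hD (h - g) (ε := 2 * ε) (by positivity) fun x => ?_).trans
    (le_of_eq (by ring))
  rw [SimpleFunc.coe_sub, Pi.sub_apply]
  have e1 := abs_le.1 (hg x)
  have e2 := abs_le.1 (hh x)
  rw [abs_le]
  constructor <;> linarith [e1.1, e1.2, e2.1, e2.2]

theorem exists_bound_simpleFunc (g : SimpleFunc X ℝ) : ∃ C, ∀ x, |g x| ≤ C := by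
  obtain ⟨C, hC⟩ := g.exists_forall_norm_le
  exact ⟨C, hC⟩

theorem abs_integral_sub_integral_le (μ : Charge X) {D : ℝ}
    (hD : ∀ E, MeasurableSet E → |μ E| ≤ D) {f h : X → ℝ} (hf : Measurable f) (hh : Measurable h)
    {C C' : ℝ} (hC : ∀ x, |f x| ≤ C) (hC' : ∀ x, |h x| ≤ C') {ε : ℝ} (hε : 0 < ε)
    (hfh : ∀ x, |f x - h x| ≤ ε) : |μ.integral f - μ.integral h| ≤ ε * (12 * D) := by
  obtain ⟨g, hg⟩ := exists_simple_approx hf hC hε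
  have h1 := μ.abs_integral_sub_simpleIntegral_le hD hf hC hε hg
  have h2 := μ.abs_integral_sub_simpleIntegral_le hD hh hC' (ε := 2 * ε) (by positivity) (g := g)
    fun x => (abs_sub_le _ (f x) _).trans (by linarith [hg x, hfh x])
  rw [abs_sub_comm] at h2
  have h3 := abs_sub_le (μ.integral f) (μ.simpleIntegral g) (μ.integral h)
  linarith

/-- The integral is linear in the charge. -/
theorem integral_eq_add_smul {μ ν ρ : Charge X} {a b : ℝ}
    (h : ∀ E, MeasurableSet E → μ E = a * ν E + b * ρ E) {f : X → ℝ} (hf : Measurable f) {C : ℝ}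
    (hC : ∀ x, |f x| ≤ C) : μ.integral f = a * ν.integral f + b * ρ.integral f := by
  have := neBot_uniformApprox hf hC
  refine tendsto_nhds_unique (μ.tendsto_integral hf hC) ((((ν.tendsto_integral hf hC).const_mul
    a).add ((ρ.tendsto_integral hf hC).const_mul b)).congr fun g => ?_)
  unfold simpleIntegral
  rw [Finset.mul_sum, Finset.mul_sum, ← Finset.sum_add_distrib]
  refine Finset.sum_congr rfl fun y _ => ?_
  rw [h _ (g.measurableSet_fiber y)]
  ring

theorem simpleIntegral_le {μ : Charge X} (hμ : μ.IsNonneg) (g : SimpleFunc X ℝ) {B : ℝ}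
    (hg : ∀ x, g x ≤ B) : μ.simpleIntegral g ≤ B * μ Set.univ := by
  have h : ∑ y ∈ g.range, μ (g ⁻¹' {y}) = μ Set.univ := by
    rw [sum_preimage]
    congr 1
    ext x
    simp
  rw [← h, Finset.mul_sum]
  refine Finset.sum_le_sum fun y hy => ?_
  obtain ⟨x, rfl⟩ := SimpleFunc.mem_range.1 hy
  exact mul_le_mul_of_nonneg_right (hg x) (hμ _ (g.measurableSet_fiber _))

theorem le_simpleIntegral {μ : Charge X} (hμ : μ.IsNonneg) (g : SimpleFunc X ℝ) {B : ℝ}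
    (hg : ∀ x, B ≤ g x) : B * μ Set.univ ≤ μ.simpleIntegral g := by
  have h : ∑ y ∈ g.range, μ (g ⁻¹' {y}) = μ Set.univ := by
    rw [sum_preimage]
    congr 1
    ext x
    simp
  rw [← h, Finset.mul_sum]
  refine Finset.sum_le_sum fun y hy => ?_
  obtain ⟨x, rfl⟩ := SimpleFunc.mem_range.1 hy
  exact mul_le_mul_of_nonneg_right (hg x) (hμ _ (g.measurableSet_fiber _))

theorem integral_le {μ : Charge X} (hμ : μ.IsNonneg) {f : X → ℝ} (hf : Measurable f) {C : ℝ}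
    (hC : ∀ x, |f x| ≤ C) {B : ℝ} (hB : ∀ x, f x ≤ B) : μ.integral f ≤ B * μ Set.univ := by
  have := neBot_uniformApprox hf hC
  refine le_of_forall_pos_le_add fun ε hε => ?_
  have h0 := hμ _ MeasurableSet.univ
  -- The `+ 1` keeps the denominator positive when `μ` has total mass `0`.
  have hδ : 0 < ε / (μ Set.univ + 1) := by positivity
  refine le_of_tendsto (μ.tendsto_integral hf hC) ?_
  filter_upwards [(hasBasis_uniformApprox f).mem_of_mem hδ] with g hg
  refine (simpleIntegral_le hμ g (B := B + ε / (μ Set.univ + 1)) fun x => ?_).trans ?_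
  · linarith [(abs_le.1 (hg x)).2, hB x]
  · have : ε / (μ Set.univ + 1) * (μ Set.univ + 1) = ε := by field_simp
    nlinarith

theorem integral_nonneg {μ : Charge X} (hμ : μ.IsNonneg) {f : X → ℝ} (hf : Measurable f) {C : ℝ}
    (hC : ∀ x, |f x| ≤ C) (hB : ∀ x, 0 ≤ f x) : 0 ≤ μ.integral f := by
  have := neBot_uniformApprox hf hC
  refine le_of_forall_pos_le_add fun ε hε => ?_
  have h0 := hμ _ MeasurableSet.univ
  have hδ : 0 < ε / (μ Set.univ + 1) := by positivity
  suffices h : -ε ≤ μ.integral f by linarith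
  refine ge_of_tendsto (μ.tendsto_integral hf hC) ?_
  filter_upwards [(hasBasis_uniformApprox f).mem_of_mem hδ] with g hg
  refine le_trans ?_ (le_simpleIntegral hμ g (B := -(ε / (μ Set.univ + 1))) fun x => ?_)
  · have : ε / (μ Set.univ + 1) * (μ Set.univ + 1) = ε := by field_simp
    nlinarith
  · linarith [(abs_le.1 (hg x)).1, hB x]

theorem markovOperator_apply (κ : Kernel X X) [IsMarkovKernel κ] (μ : Charge X) {E : Set X}
    (hE : MeasurableSet E) : μ.markovOperator κ E = μ.integral (fun x => (κ x).real E) := by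
  simp [markovOperator, hE]

/-! ### Finite measures as charges. -/

open Classical in
/-- The charge of a finite measure. -/
noncomputable def ofMeasure (m : Measure X) [IsFiniteMeasure m] : Charge X where
  toFun E := if MeasurableSet E then m.real E else 0
  not_measurable' E hE := by simp [hE]
  empty' := by simp
  union' E F hE hF hd := by rw [if_pos hE, if_pos hF, if_pos (hE.union hF), measureReal_union hd hF]
  bounded' := ⟨m.real Set.univ, fun E hE => by
    rw [if_pos hE, abs_of_nonneg measureReal_nonneg]
    exact measureReal_mono (Set.subset_univ _)⟩

theorem ofMeasure_apply (m : Measure X) [IsFiniteMeasure m] {E : Set X} (hE : MeasurableSet E) :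
    ofMeasure m E = m.real E := by
  simp [ofMeasure, hE]

theorem isNonneg_ofMeasure (m : Measure X) [IsFiniteMeasure m] : (ofMeasure m).IsNonneg :=
  fun E hE => by rw [ofMeasure_apply m hE]; exact measureReal_nonneg

theorem isCountablyAdditive_ofMeasure (m : Measure X) [IsFiniteMeasure m] :
    (ofMeasure m).IsCountablyAdditive := by
  intro E hE hd
  simp only [ofMeasure_apply m (hE _), ofMeasure_apply m (MeasurableSet.iUnion hE), Measure.real]
  rw [measure_iUnion hd hE]
  have hfin : ∑' n, m (E n) ≠ ⊤ := by
    rw [← measure_iUnion hd hE]; exact measure_ne_top _ _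
  rw [ENNReal.tsum_toReal_eq fun n => measure_ne_top _ _]
  exact (ENNReal.summable_toReal hfin).hasSum

theorem simpleIntegral_ofMeasure (m : Measure X) [IsFiniteMeasure m] (g : SimpleFunc X ℝ) :
    (ofMeasure m).simpleIntegral g = ∫ x, g x ∂m := by
  have hi : Integrable g m := g.integrable_of_isFiniteMeasure
  rw [SimpleFunc.integral_eq_sum g hi]
  refine Finset.sum_congr rfl fun y _ => ?_
  rw [ofMeasure_apply m (g.measurableSet_fiber y), smul_eq_mul, mul_comm]

theorem integrable_of_abs_le {m : Measure X} [IsFiniteMeasure m] {f : X → ℝ} (hf : Measurable f)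
    {C : ℝ} (hC : ∀ x, |f x| ≤ C) : Integrable f m :=
  Integrable.of_bound hf.aestronglyMeasurable C (ae_of_all _ hC)

theorem abs_integral_sub_integral_simpleFunc_le (m : Measure X) [IsFiniteMeasure m] {f : X → ℝ}
    (hf : Measurable f) {C : ℝ} (hC : ∀ x, |f x| ≤ C) {ε : ℝ} {g : SimpleFunc X ℝ}
    (hg : ∀ x, |g x - f x| ≤ ε) : |(∫ x, f x ∂m) - ∫ x, g x ∂m| ≤ ε * m.real Set.univ := by
  rw [← MeasureTheory.integral_sub (integrable_of_abs_le (m := m) hf hC)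
    (show Integrable g m from g.integrable_of_isFiniteMeasure)]
  refine (Real.norm_eq_abs _).symm.trans_le (norm_integral_le_of_norm_le_const (ae_of_all _ fun x => ?_))
  rw [Real.norm_eq_abs, abs_sub_comm]
  exact hg x

theorem integral_ofMeasure (m : Measure X) [IsFiniteMeasure m] {f : X → ℝ} (hf : Measurable f)
    {C : ℝ} (hC : ∀ x, |f x| ≤ C) : (ofMeasure m).integral f = ∫ x, f x ∂m := by
  obtain ⟨D, hD⟩ := (ofMeasure m).bounded'
  refine eq_of_forall_abs_sub_le (K := 4 * D + m.real Set.univ) fun ε hε => ?_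
  obtain ⟨g, hg⟩ := exists_simple_approx hf hC hε
  have h1 := (ofMeasure m).abs_integral_sub_simpleIntegral_le hD hf hC hε hg
  have h2 := abs_integral_sub_integral_simpleFunc_le m hf hC hg
  rw [simpleIntegral_ofMeasure] at h1
  rw [abs_sub_comm] at h2
  have h3 := abs_sub_le ((ofMeasure m).integral f) (∫ x, g x ∂m) (∫ x, f x ∂m)
  linarith

theorem real_bind_apply (κ : Kernel X X) [IsMarkovKernel κ] (m : Measure X) [IsFiniteMeasure m]
    {E : Set X} (hE : MeasurableSet E) : (m.bind κ).real E = ∫ x, (κ x).real E ∂m := by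
  rw [Measure.real, Measure.bind_apply hE κ.aemeasurable]
  exact (MeasureTheory.integral_toReal (κ.measurable_coe hE).aemeasurable
    (ae_of_all _ fun x => measure_lt_top _ _)).symm

theorem markovOperator_ofMeasure (κ : Kernel X X) [IsMarkovKernel κ] (m : Measure X)
    [IsFiniteMeasure m] : (ofMeasure m).markovOperator κ = ofMeasure (m.bind κ) := by
  refine ext_of_measurable fun E hE => ?_
  rw [markovOperator_apply κ _ hE, ofMeasure_apply _ hE, real_bind_apply κ m hE,
    integral_ofMeasure m (measurable_kernel_real κ hE) (abs_kernel_real_le κ E)]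

/-! ### Duality and iterates of the transition function. -/

theorem integral_finset_sum (μ : Charge X) {ι : Type*} (s : Finset ι) (f : ι → X → ℝ)
    (hf : ∀ i, Measurable (f i)) (hC : ∀ i, ∃ C, ∀ x, |f i x| ≤ C) :
    μ.integral (fun x => ∑ i ∈ s, f i x) = ∑ i ∈ s, μ.integral (f i) := by
  classical
  choose C hC using hC
  induction s using Finset.induction_on with
  | empty =>
    have h := μ.integral_add (f₁ := fun _ => 0) (f₂ := fun _ => 0) (C₁ := 0) (C₂ := 0)
      measurable_const measurable_const (by simp) (by simp)
    simp only [add_zero] at h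
    simp only [Finset.sum_empty]
    linarith
  | insert a s ha ih =>
    simp only [Finset.sum_insert ha]
    rw [μ.integral_add (hf a) (Finset.measurable_sum _ fun i _ => hf i) (hC a)
      (C₂ := ∑ i ∈ s, C i)
      fun x => (Finset.abs_sum_le_sum_abs _ _).trans (Finset.sum_le_sum fun i _ => hC i x), ih]

theorem integral_const_mul (μ : Charge X) (a : ℝ) {f : X → ℝ} (hf : Measurable f) {C : ℝ}
    (hC : ∀ x, |f x| ≤ C) : μ.integral (fun x => a * f x) = a * μ.integral f := by
  have hm : ∀ g : SimpleFunc X ℝ, μ.simpleIntegral (SimpleFunc.const X a * g)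
      = a * μ.simpleIntegral g := by
    intro g
    rw [simpleIntegral_eq, simpleIntegral_eq]
    exact SimpleFunc.setToSimpleFunc_smul_real _ μ.finMeasAdditive a (f := g) (μ := 0)
      (integrable_zero_measure)
  obtain ⟨D, hD⟩ := μ.bounded'
  have hC' : ∀ x, |a * f x| ≤ |a| * C := fun x => by
    rw [abs_mul]; exact mul_le_mul_of_nonneg_left (hC x) (abs_nonneg _)
  refine eq_of_forall_abs_sub_le (K := (|a| + 1) * (4 * D) + |a| * (4 * D)) fun ε hε => ?_
  obtain ⟨g, hg⟩ := exists_simple_approx hf hC hε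
  have h1 := μ.abs_integral_sub_simpleIntegral_le hD hf hC hε hg
  have h2 := μ.abs_integral_sub_simpleIntegral_le hD (hf.const_mul a) hC'
    -- `|a| + 1` rather than `|a|`, so that the tolerance is positive even for `a = 0`.
    (ε := (|a| + 1) * ε) (by positivity) (g := SimpleFunc.const X a * g) fun x => by
      rw [SimpleFunc.coe_mul, Pi.mul_apply, SimpleFunc.coe_const, Function.const_apply,
        ← mul_sub, abs_mul]
      nlinarith [hg x, abs_nonneg a, abs_nonneg (g x - f x)]
  rw [hm] at h2
  have h3 := abs_sub_le (μ.integral fun x => a * f x) (a * μ.simpleIntegral g) (a * μ.integral f)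
  have h4 : |a * μ.simpleIntegral g - a * μ.integral f| ≤ |a| * (ε * (4 * D)) := by
    rw [← mul_sub, abs_mul, abs_sub_comm]
    exact mul_le_mul_of_nonneg_left h1 (abs_nonneg _)
  linarith

/-- Duality between `A` and the action of the kernel on functions. For simple `f` it is linearity of
the integral; both sides are Lipschitz in `f` for the sup norm, so uniform approximation gives the
rest. -/
theorem integral_markovOperator (κ : Kernel X X) [IsMarkovKernel κ] (μ : Charge X) {f : X → ℝ}
    (hf : Measurable f) {C : ℝ} (hC : ∀ x, |f x| ≤ C) :
    (μ.markovOperator κ).integral f = μ.integral (fun x => ∫ y, f y ∂κ x) := by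
  obtain ⟨D, hD⟩ := μ.bounded'
  obtain ⟨D', hD'⟩ := (μ.markovOperator κ).bounded'
  have hmeas : ∀ h : X → ℝ, Measurable h → Measurable (fun x => ∫ y, h y ∂κ x) := fun h hh =>
    (hh.stronglyMeasurable.integral_kernel).measurable
  have hbound : ∀ {h : X → ℝ} {B : ℝ}, (∀ x, |h x| ≤ B) → ∀ x, |∫ y, h y ∂κ x| ≤ B :=
    fun {h B} hB x => by
      simpa using norm_integral_le_of_norm_le_const (μ := κ x) (f := h) (C := B) (ae_of_all _ hB)
  have hsimple : ∀ g : SimpleFunc X ℝ,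
      (μ.markovOperator κ).simpleIntegral g = μ.integral (fun x => ∫ y, g y ∂κ x) := by
    intro g
    have : (fun x => ∫ y, g y ∂κ x) = fun x => ∑ y ∈ g.range, y * (κ x).real (g ⁻¹' {y}) := by
      funext x
      rw [SimpleFunc.integral_eq_sum g g.integrable_of_isFiniteMeasure]
      exact Finset.sum_congr rfl fun y _ => by rw [smul_eq_mul, mul_comm]
    rw [this, integral_finset_sum]
    · refine Finset.sum_congr rfl fun y _ => ?_
      rw [markovOperator_apply κ μ (g.measurableSet_fiber y), integral_const_mul μ y
        (measurable_kernel_real κ (g.measurableSet_fiber y)) (abs_kernel_real_le κ _)]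
    · exact fun y => (measurable_kernel_real κ (g.measurableSet_fiber y)).const_mul y
    · refine fun y => ⟨|y| * 1, fun x => ?_⟩
      rw [abs_mul]
      exact mul_le_mul_of_nonneg_left (abs_kernel_real_le κ _ x) (abs_nonneg _)
  refine eq_of_forall_abs_sub_le (K := 4 * D' + 12 * D) fun ε hε => ?_
  obtain ⟨g, hg⟩ := exists_simple_approx hf hC hε
  obtain ⟨B, hB⟩ := exists_bound_simpleFunc g
  have h1 := (μ.markovOperator κ).abs_integral_sub_simpleIntegral_le hD' hf hC hε hg
  have h2 := μ.abs_integral_sub_integral_le hD (hmeas g g.measurable) (hmeas f hf) (hbound hB)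
    (hbound hC) hε fun x => by
      rw [abs_sub_comm]
      simpa using abs_integral_sub_integral_simpleFunc_le (κ x) hf hC hg
  rw [hsimple] at h1
  have h3 := abs_sub_le ((μ.markovOperator κ).integral f) (μ.integral fun x => ∫ y, g y ∂κ x)
    (μ.integral fun x => ∫ y, f y ∂κ x)
  linarith

theorem integral_pow_succ (κ : Kernel X X) [IsMarkovKernel κ] {μ : Charge X}
    (h : μ.markovOperator κ = μ) (k : ℕ) {E : Set X} (hE : MeasurableSet E) :
    μ.integral (fun x => ((κ ^ (k + 1)) x).real E) = μ E := by
  induction k with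
  | zero =>
    simp only [zero_add, pow_one]
    rw [← markovOperator_apply κ μ hE, h]
  | succ k ih =>
    have := isMarkovKernel_pow κ (k + 1)
    rw [← ih]
    -- Invariance inserts one application of `A`, which duality moves onto the integrand as one more
    -- step of the chain.
    conv_rhs => rw [← h]
    rw [integral_markovOperator κ μ (measurable_kernel_real _ hE) (abs_kernel_real_le _ E)]
    congr 1
    funext x
    rw [← real_bind_apply (κ ^ (k + 1)) (κ x) hE, Kernel.pow_add κ (k + 1) 1, pow_one κ,
      Kernel.comp_apply]

/-! ### Setwise limits of probability measures. -/

/-- The limit along an ultrafilter of a sequence of probability measures. -/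
theorem exists_tendsto_hyperfilter (m : ℕ → Measure X) [∀ n, IsProbabilityMeasure (m n)] :
    ∃ μ : Charge X, μ.IsProbability ∧
      ∀ E, MeasurableSet E → Tendsto (fun n => (m n).real E) (hyperfilter ℕ) (𝓝 (μ E)) := by
  classical
  have hex : ∀ E, ∃ l, Tendsto (fun n => (m n).real E) (hyperfilter ℕ) (𝓝 l) := fun E => by
    obtain ⟨l, -, hl⟩ := (isCompact_Icc (a := (0 : ℝ)) (b := 1)).ultrafilter_le_nhds
      ((hyperfilter ℕ).map fun n => (m n).real E) (by
        rw [le_principal_iff, Ultrafilter.mem_coe, Ultrafilter.mem_map]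
        exact Filter.univ_mem' fun n => ⟨measureReal_nonneg, measureReal_le_one⟩)
    exact ⟨l, hl⟩
  choose L hL using hex
  have h0 : ∀ E, 0 ≤ L E := fun E => ge_of_tendsto' (hL E) fun n => measureReal_nonneg
  have h1 : ∀ E, L E ≤ 1 := fun E => le_of_tendsto' (hL E) fun n => measureReal_le_one
  refine ⟨⟨fun E => if MeasurableSet E then L E else 0, fun E hE => by simp [hE], ?_, ?_, ?_⟩,
    ⟨?_, ?_⟩, ?_⟩
  · rw [if_pos MeasurableSet.empty]
    exact tendsto_nhds_unique (hL ∅) (by simp)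
  · intro E F hE hF hd
    rw [if_pos hE, if_pos hF, if_pos (hE.union hF)]
    refine tendsto_nhds_unique (hL _) (((hL E).add (hL F)).congr fun n => ?_)
    rw [measureReal_union hd hF]
  · refine ⟨1, fun E hE => ?_⟩
    rw [if_pos hE, abs_of_nonneg (h0 E)]
    exact h1 E
  · intro E hE
    change 0 ≤ if MeasurableSet E then L E else 0
    rw [if_pos hE]
    exact h0 E
  · change (if MeasurableSet Set.univ then L Set.univ else 0) = 1
    rw [if_pos MeasurableSet.univ]
    exact tendsto_nhds_unique (hL _) (by simp)
  · intro E hE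
    change Tendsto _ _ (𝓝 (if MeasurableSet E then L E else 0))
    rw [if_pos hE]
    exact hL E

theorem tendsto_integral_of_tendsto {l : Filter ℕ} {m : ℕ → Measure X}
    [∀ n, IsProbabilityMeasure (m n)] {μ : Charge X}
    (h : ∀ E, MeasurableSet E → Tendsto (fun n => (m n).real E) l (𝓝 (μ E))) {f : X → ℝ}
    (hf : Measurable f) {C : ℝ} (hC : ∀ x, |f x| ≤ C) :
    Tendsto (fun n => ∫ x, f x ∂m n) l (𝓝 (μ.integral f)) := by
  obtain ⟨D, hD⟩ := μ.bounded'
  have hD0 : 0 ≤ D := (abs_nonneg _).trans (hD ∅ MeasurableSet.empty)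
  rw [Metric.tendsto_nhds]
  intro ε hε
  have hδ : 0 < ε / (4 * D + 3) := by positivity
  have hδε : ε / (4 * D + 3) * (4 * D + 3) = ε := by field_simp
  obtain ⟨g, hg⟩ := exists_simple_approx hf hC hδ
  have hlim : Tendsto (fun n => ∫ x, g x ∂m n) l (𝓝 (μ.simpleIntegral g)) := by
    simp only [← simpleIntegral_ofMeasure]
    refine tendsto_finsetSum _ fun y _ => Tendsto.const_mul y ?_
    simp only [ofMeasure_apply _ (g.measurableSet_fiber y)]
    exact h _ (g.measurableSet_fiber y)
  have h1 := μ.abs_integral_sub_simpleIntegral_le hD hf hC hδ hg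
  filter_upwards [Metric.tendsto_nhds.1 hlim _ hδ] with n hn
  have h2 := abs_integral_sub_integral_simpleFunc_le (m n) hf hC hg
  rw [probReal_univ, mul_one] at h2
  rw [Real.dist_eq] at hn ⊢
  rw [abs_sub_comm] at h1
  have h3 := abs_sub_le (∫ x, f x ∂m n) (∫ x, g x ∂m n) (μ.integral f)
  have h4 := abs_sub_le (∫ x, g x ∂m n) (μ.simpleIntegral g) (μ.integral f)
  linarith

/-- Setwise convergence extends to integrals of bounded measurable functions, in particular to `p(·,
E)`, so `A` commutes with the limit and asymptotic invariance becomes exact. -/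
theorem markovOperator_eq_of_tendsto {l : Filter ℕ} [l.NeBot] (κ : Kernel X X) [IsMarkovKernel κ]
    {m : ℕ → Measure X} [∀ n, IsProbabilityMeasure (m n)] {μ : Charge X}
    (h : ∀ E, MeasurableSet E → Tendsto (fun n => (m n).real E) l (𝓝 (μ E)))
    (hinv : ∀ E, MeasurableSet E →
      Tendsto (fun n => ((m n).bind κ).real E - (m n).real E) l (𝓝 0)) :
    μ.markovOperator κ = μ := by
  refine ext_of_measurable fun E hE => ?_
  rw [markovOperator_apply κ μ hE]
  refine tendsto_nhds_unique (tendsto_integral_of_tendsto h (measurable_kernel_real κ hE)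
    (abs_kernel_real_le κ E)) ?_
  have := (hinv E hE).add (h E hE)
  rw [zero_add] at this
  refine this.congr fun n => ?_
  rw [sub_add_cancel, real_bind_apply κ _ hE]

/-! ### The countably additive part of a charge. -/

theorem ofReal_iUnion_eq_tsum {μ : Charge X} (hμ : μ.IsNonneg) (hca : μ.IsCountablyAdditive)
    {E : ℕ → Set X} (hE : ∀ n, MeasurableSet (E n)) (hd : Pairwise (Function.onFun Disjoint E)) :
    ENNReal.ofReal (μ (⋃ n, E n)) = ∑' n, ENNReal.ofReal (μ (E n)) := by
  have := hca E hE hd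
  rw [← this.tsum_eq, ENNReal.ofReal_tsum_of_nonneg (fun n => hμ _ (hE n)) this.summable]

theorem exists_eq_ofMeasure {μ : Charge X} (hμ : μ.IsNonneg) (hca : μ.IsCountablyAdditive) :
    ∃ (m : Measure X) (_ : IsFiniteMeasure m), μ = ofMeasure m := by
  let m : Measure X := Measure.ofMeasurable (fun E _ => ENNReal.ofReal (μ E)) (by simp [μ.empty'])
    fun E hE hd => ofReal_iUnion_eq_tsum hμ hca hE hd
  have hm : ∀ E, MeasurableSet E → m E = ENNReal.ofReal (μ E) := fun E hE =>
    Measure.ofMeasurable_apply E hE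
  have : IsFiniteMeasure m := ⟨by rw [hm _ MeasurableSet.univ]; exact ENNReal.ofReal_lt_top⟩
  refine ⟨m, this, ext_of_measurable fun E hE => ?_⟩
  rw [ofMeasure_apply m hE, Measure.real, hm E hE, ENNReal.toReal_ofReal (hμ E hE)]

theorem mono {μ : Charge X} (hμ : μ.IsNonneg) {E F : Set X} (hE : MeasurableSet E)
    (hF : MeasurableSet F) (h : E ⊆ F) : μ E ≤ μ F := by
  have := μ.union' E (F \ E) hE (hF.diff hE) Set.disjoint_sdiff_right
  rw [Set.union_sdiff_cancel h] at this
  linarith [hμ _ (hF.diff hE)]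

open Classical in
/-- The set function extending a charge by `∞` to non-measurable sets. -/
noncomputable def extend (μ : Charge X) (E : Set X) : ENNReal :=
  if MeasurableSet E then ENNReal.ofReal (μ E) else ⊤

theorem extend_empty (μ : Charge X) : μ.extend ∅ = 0 := by simp [extend, μ.empty']

theorem extend_apply (μ : Charge X) {E : Set X} (hE : MeasurableSet E) :
    μ.extend E = ENNReal.ofReal (μ E) := by simp [extend, hE]

/-- On measurable test sets finite additivity gives the splitting exactly; on the others the value
`⊤` makes it trivial. -/
theorem le_caratheodory_extend {μ : Charge X} (hμ : μ.IsNonneg) :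
    ‹MeasurableSpace X› ≤ (OuterMeasure.ofFunction μ.extend μ.extend_empty).caratheodory := by
  intro s hs
  refine OuterMeasure.ofFunction_caratheodory fun t => ?_
  by_cases ht : MeasurableSet t
  · rw [extend_apply μ ht, extend_apply μ (ht.inter hs), extend_apply μ (ht.diff hs),
      ← ENNReal.ofReal_add (hμ _ (ht.inter hs)) (hμ _ (ht.diff hs)),
      ← μ.union' _ _ (ht.inter hs) (ht.diff hs)
        (Set.disjoint_sdiff_right.mono_left Set.inter_subset_right), Set.inter_union_sdiff]
  · simp [extend, ht]

/-- The countably additive part of a nonnegative charge, in the Yosida-Hewitt decomposition. -/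
noncomputable def countablyAdditivePart {μ : Charge X} (hμ : μ.IsNonneg) : Measure X :=
  (OuterMeasure.ofFunction μ.extend μ.extend_empty).toMeasure (le_caratheodory_extend hμ)

theorem countablyAdditivePart_apply_le {μ : Charge X} (hμ : μ.IsNonneg) {E : Set X}
    (hE : MeasurableSet E) : countablyAdditivePart hμ E ≤ ENNReal.ofReal (μ E) := by
  rw [countablyAdditivePart, toMeasure_apply _ _ hE, ← extend_apply μ hE]
  exact OuterMeasure.ofFunction_le E

instance isFiniteMeasure_countablyAdditivePart {μ : Charge X} (hμ : μ.IsNonneg) :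
    IsFiniteMeasure (countablyAdditivePart hμ) :=
  ⟨(countablyAdditivePart_apply_le hμ MeasurableSet.univ).trans_lt ENNReal.ofReal_lt_top⟩

theorem real_countablyAdditivePart_le {μ : Charge X} (hμ : μ.IsNonneg) {E : Set X}
    (hE : MeasurableSet E) : (countablyAdditivePart hμ).real E ≤ μ E :=
  ENNReal.toReal_le_of_le_ofReal (hμ E hE) (countablyAdditivePart_apply_le hμ hE)

/-- The countably additive part of a charge is its greatest countably additive minorant. -/
theorem le_countablyAdditivePart {μ : Charge X} (hμ : μ.IsNonneg) {m : Measure X}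
    [IsFiniteMeasure m] (h : ∀ E, MeasurableSet E → m.real E ≤ μ E) :
    m ≤ countablyAdditivePart hμ := by
  have hle : m.toOuterMeasure ≤ OuterMeasure.ofFunction μ.extend μ.extend_empty := by
    rw [OuterMeasure.le_ofFunction]
    intro s
    by_cases hs : MeasurableSet s
    · rw [extend_apply μ hs]
      exact (ENNReal.le_ofReal_iff_toReal_le (measure_ne_top m s) (hμ s hs)).2 (h s hs)
    · simp [extend, hs]
  refine Measure.le_iff.2 fun s hs => ?_
  rw [countablyAdditivePart, toMeasure_apply _ _ hs]
  exact hle s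

theorem not_isNonnegPurelyFinitelyAdditive_of_isCountablyAdditive {μ : Charge X}
    (hμ : μ.IsProbability) (hca : μ.IsCountablyAdditive) :
    ¬ μ.IsNonnegPurelyFinitelyAdditive := by
  intro h
  have h0 := h.2 μ hca hμ.1 (fun E _ => le_rfl) Set.univ MeasurableSet.univ
  rw [hμ.2] at h0
  exact one_ne_zero h0

theorem countablyAdditivePart_eq_zero {μ : Charge X} (h : μ.IsNonnegPurelyFinitelyAdditive) :
    countablyAdditivePart h.1 = 0 := by
  have h0 := h.2 (ofMeasure (countablyAdditivePart h.1)) (isCountablyAdditive_ofMeasure _)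
    (isNonneg_ofMeasure _) (fun E hE => by
      rw [ofMeasure_apply _ hE]; exact real_countablyAdditivePart_le h.1 hE)
    Set.univ MeasurableSet.univ
  rw [ofMeasure_apply _ MeasurableSet.univ] at h0
  exact Measure.measure_univ_eq_zero.1 ((measureReal_eq_zero_iff).1 h0)

/-! ### Doeblin's condition excludes purely finitely additive invariant charges. -/

theorem biUnion_range_le_sum {μ : Charge X} (hμ : μ.IsNonneg) {E : ℕ → Set X}
    (hE : ∀ n, MeasurableSet (E n)) (n : ℕ) :
    μ (⋃ i ∈ Finset.range n, E i) ≤ ∑ i ∈ Finset.range n, μ (E i) := by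
  induction n with
  | zero => simp [μ.empty']
  | succ n ih =>
    have hU : MeasurableSet (⋃ i ∈ Finset.range n, E i) :=
      Finset.measurableSet_biUnion _ fun i _ => hE i
    rw [Finset.sum_range_succ, Finset.range_add_one, Finset.set_biUnion_insert, Set.union_comm,
      ← Set.union_sdiff_self, μ.union' _ _ hU ((hE n).diff hU) Set.disjoint_sdiff_right]
    exact add_le_add ih (mono hμ ((hE n).diff hU) (hE n) Set.sdiff_subset)

/-- A purely finitely additive charge is almost concentrated on sets of small measure. -/
theorem exists_measure_compl_le {μ : Charge X} (h : μ.IsNonnegPurelyFinitelyAdditive)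
    (φ : Measure X) [IsFiniteMeasure φ] {ε : ℝ} (hε : 0 < ε) :
    ∃ E, MeasurableSet E ∧ φ.real E ≤ ε ∧ μ Eᶜ ≤ ε := by
  -- The countably additive part vanishes, so `X` has a countable cover of total `μ`-mass below `ε`.
  -- Its finite subunions stay `μ`-small, while their complements become `φ`-small.
  have h0 : (OuterMeasure.ofFunction μ.extend μ.extend_empty) Set.univ < ENNReal.ofReal ε := by
    rw [← toMeasure_apply _ (le_caratheodory_extend h.1) MeasurableSet.univ]
    change countablyAdditivePart h.1 Set.univ < _
    rw [countablyAdditivePart_eq_zero h]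
    simpa using hε
  rw [OuterMeasure.ofFunction_apply] at h0
  simp only [iInf_lt_iff] at h0
  obtain ⟨t, ht, hsum⟩ := h0
  -- A non-measurable member of the cover would contribute `⊤` to the sum.
  have htm : ∀ n, MeasurableSet (t n) := by
    intro n
    by_contra hn
    have : μ.extend (t n) = ⊤ := by simp [extend, hn]
    have h2 := ENNReal.le_tsum (f := fun n => μ.extend (t n)) n
    rw [this] at h2
    exact absurd (h2.trans_lt hsum) (by simp)
  simp only [extend_apply μ (htm _)] at hsum
  have hU : ∀ n, MeasurableSet (⋃ i ∈ Finset.range n, t i) := fun n =>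
    Finset.measurableSet_biUnion _ fun i _ => htm i
  have hμU : ∀ n, μ (⋃ i ∈ Finset.range n, t i) ≤ ε := by
    intro n
    refine (biUnion_range_le_sum h.1 htm n).trans ?_
    refine (ENNReal.ofReal_le_ofReal_iff hε.le).1 ?_
    rw [ENNReal.ofReal_sum_of_nonneg fun i _ => h.1 _ (htm i)]
    exact (ENNReal.sum_le_tsum _).trans hsum.le
  have hanti : Antitone fun n => (⋃ i ∈ Finset.range n, t i)ᶜ := by
    intro a b hab
    refine Set.compl_subset_compl.2 (Set.biUnion_subset_biUnion_left ?_)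
    exact fun i hi => Finset.range_mono hab hi
  have hlim := tendsto_measure_iInter_atTop (μ := φ) (fun n => (hU n).compl.nullMeasurableSet)
    hanti ⟨0, measure_ne_top _ _⟩
  have hempty : ⋂ n, (⋃ i ∈ Finset.range n, t i)ᶜ = ∅ := by
    rw [← Set.compl_iUnion, Set.compl_empty_iff, Set.eq_univ_iff_forall]
    intro x
    obtain ⟨i, hi⟩ := Set.mem_iUnion.1 (ht (Set.mem_univ x))
    simp only [Set.mem_iUnion]
    exact ⟨i + 1, i, by simp, hi⟩
  rw [hempty, measure_empty] at hlim
  obtain ⟨n, hn⟩ := (hlim.eventually (gt_mem_nhds (ENNReal.ofReal_pos.2 hε))).exists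
  refine ⟨_, (hU n).compl, ENNReal.toReal_le_of_le_ofReal hε.le hn.le, ?_⟩
  rw [compl_compl]
  exact hμU n

theorem not_isNonnegPurelyFinitelyAdditive_of_doeblinCondition {κ : Kernel X X} [IsMarkovKernel κ]
    (hD : DoeblinCondition κ) {μ : Charge X} (hμ : μ ∈ invariantCharges κ) :
    ¬ μ.IsNonnegPurelyFinitelyAdditive := by
  intro h
  obtain ⟨φ, _, ε, hε, k, hk, hD⟩ := hD
  obtain ⟨k, rfl⟩ := Nat.exists_eq_add_of_le' hk
  -- Half of `ε` suffices: `μ E ≥ 1 - ε / 2` will contradict `μ E ≤ 1 - ε`.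
  obtain ⟨E, hE, hφ, hμE⟩ := exists_measure_compl_le h φ (half_pos hε)
  have := isMarkovKernel_pow κ (k + 1)
  have h1 := integral_pow_succ κ hμ.2 k hE
  have h2 := integral_le h.1 (measurable_kernel_real (κ ^ (k + 1)) hE)
    (abs_kernel_real_le _ E) (hD E hE (hφ.trans (half_le_self hε.le)))
  rw [h1, hμ.1.2] at h2
  have h3 := μ.union' E Eᶜ hE hE.compl disjoint_compl_right
  rw [Set.union_compl_self, hμ.1.2] at h3
  linarith

/-! ### Invariance of the Yosida–Hewitt components. -/

/-- The difference of a charge and a finite measure, multiplied by a constant. -/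
noncomputable def scaledSub (μ : Charge X) (m : Measure X) [IsFiniteMeasure m] (c : ℝ) :
    Charge X where
  toFun E := c * μ E + (-c) * ofMeasure m E
  not_measurable' E hE := by rw [μ.not_measurable' E hE, (ofMeasure m).not_measurable' E hE]; simp
  empty' := by rw [μ.empty', (ofMeasure m).empty']; simp
  union' E F hE hF hd := by
    rw [μ.union' E F hE hF hd, (ofMeasure m).union' E F hE hF hd]
    ring
  bounded' := by
    obtain ⟨C, hC⟩ := μ.bounded'
    obtain ⟨D, hD⟩ := (ofMeasure m).bounded'
    refine ⟨|c| * C + |-c| * D, fun E hE => (abs_add_le _ _).trans ?_⟩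
    rw [abs_mul, abs_mul]
    exact add_le_add (mul_le_mul_of_nonneg_left (hC E hE) (abs_nonneg _))
      (mul_le_mul_of_nonneg_left (hD E hE) (abs_nonneg _))

theorem scaledSub_apply (μ : Charge X) (m : Measure X) [IsFiniteMeasure m] (c : ℝ) {E : Set X}
    (hE : MeasurableSet E) : μ.scaledSub m c E = c * (μ E - m.real E) := by
  change c * μ E + (-c) * ofMeasure m E = _
  rw [ofMeasure_apply m hE]
  ring

theorem markovOperator_scaledSub (κ : Kernel X X) [IsMarkovKernel κ] (μ : Charge X) (m : Measure X)
    [IsFiniteMeasure m] (c : ℝ) {E : Set X} (hE : MeasurableSet E) :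
    (μ.scaledSub m c).markovOperator κ E = c * (μ.markovOperator κ E - (m.bind κ).real E) := by
  rw [markovOperator_apply κ _ hE, markovOperator_apply κ _ hE,
    integral_eq_add_smul (fun E _ => rfl) (measurable_kernel_real κ hE) (abs_kernel_real_le κ E),
    integral_ofMeasure m (measurable_kernel_real κ hE) (abs_kernel_real_le κ E),
    real_bind_apply κ m hE]
  ring

/-- With `m` the countably additive part, positivity of `A (μ - m)` gives `m.bind κ ≤ μ`, and
maximality of `m` gives `m.bind κ ≤ m`. A Markov kernel preserves total mass, so equality holds. -/
theorem bind_countablyAdditivePart {κ : Kernel X X} [IsMarkovKernel κ] {μ : Charge X}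
    (hμ : μ.IsNonneg) (hinv : μ.markovOperator κ = μ) :
    (countablyAdditivePart hμ).bind κ = countablyAdditivePart hμ := by
  refine Measure.eq_of_le_of_measure_univ_eq (le_countablyAdditivePart hμ fun E hE => ?_) ?_
  · have hnn : (μ.scaledSub (countablyAdditivePart hμ) 1).IsNonneg := fun E hE => by
      rw [scaledSub_apply _ _ _ hE, one_mul, sub_nonneg]
      exact real_countablyAdditivePart_le hμ hE
    have h := integral_nonneg hnn (measurable_kernel_real κ hE) (abs_kernel_real_le κ E)
      fun x => measureReal_nonneg
    rw [← markovOperator_apply κ _ hE, markovOperator_scaledSub κ _ _ _ hE, hinv] at h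
    linarith
  · simp [Measure.bind_apply MeasurableSet.univ κ.aemeasurable]

/-- If an invariant charge is not countably additive, its purely finitely additive part yields
a purely finitely additive invariant charge. -/
theorem exists_isNonnegPurelyFinitelyAdditive {κ : Kernel X X} [IsMarkovKernel κ] {μ : Charge X}
    (hμ : μ ∈ invariantCharges κ) (hca : ¬ μ.IsCountablyAdditive) :
    ∃ ν ∈ invariantCharges κ, ν.IsNonnegPurelyFinitelyAdditive := by
  obtain ⟨⟨hnn, huniv⟩, hinv⟩ := hμ
  set m := countablyAdditivePart hnn
  have hle : ∀ E, MeasurableSet E → m.real E ≤ μ E := fun E hE =>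
    real_countablyAdditivePart_le hnn hE
  have hlt : m.real Set.univ < 1 := by
    -- If `m` had full mass, `m ≤ μ` on both `E` and `Eᶜ` would force `μ = m`.
    refine lt_of_le_of_ne (huniv ▸ hle _ MeasurableSet.univ) fun h1 => hca ?_
    suffices h : μ = ofMeasure m from h ▸ isCountablyAdditive_ofMeasure m
    refine ext_of_measurable fun E hE => ?_
    rw [ofMeasure_apply m hE]
    have h2 := μ.union' E Eᶜ hE hE.compl disjoint_compl_right
    have h3 := measureReal_add_measureReal_compl (μ := m) hE
    rw [Set.union_compl_self] at h2
    linarith [hle E hE, hle _ hE.compl]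
  set c := (1 - m.real Set.univ)⁻¹ with hc
  have hc0 : 0 < c := inv_pos.2 (sub_pos.2 hlt)
  have hnn' : (μ.scaledSub m c).IsNonneg := fun E hE => by
    rw [scaledSub_apply _ _ _ hE]
    exact mul_nonneg hc0.le (sub_nonneg.2 (hle E hE))
  refine ⟨μ.scaledSub m c, ⟨⟨hnn', ?_⟩, ?_⟩, hnn', ?_⟩
  · rw [scaledSub_apply _ _ _ MeasurableSet.univ, huniv, hc]
    exact inv_mul_cancel₀ (sub_pos.2 hlt).ne'
  · refine ext_of_measurable fun E hE => ?_
    rw [markovOperator_scaledSub κ _ _ _ hE, scaledSub_apply _ _ _ hE, hinv,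
      bind_countablyAdditivePart hnn hinv]
  · intro ν hνca hνnn hν E hE
    obtain ⟨n, _, rfl⟩ := exists_eq_ofMeasure hνnn hνca
    -- From `n ≤ c (μ - m)`, the measure `m + c⁻¹ n` is again a countably additive minorant of `μ`;
    -- maximality of `m` leaves no room for `n`.
    have hsum : m + ENNReal.ofReal c⁻¹ • n ≤ m := by
      have : IsFiniteMeasure (ENNReal.ofReal c⁻¹ • n) := n.smul_finite ENNReal.ofReal_ne_top
      refine le_countablyAdditivePart hnn fun F hF => ?_
      have h1 := hν F hF
      rw [scaledSub_apply _ _ _ hF, ofMeasure_apply n hF] at h1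
      rw [measureReal_add_apply, measureReal_ennreal_smul_apply,
        ENNReal.toReal_ofReal (inv_nonneg.2 hc0.le)]
      have h2 := mul_le_mul_of_nonneg_left h1 (inv_nonneg.2 hc0.le)
      rw [inv_mul_cancel_left₀ hc0.ne'] at h2
      linarith
    have h1 := hsum E
    have h2 : n E = 0 := by
      rw [Measure.add_apply, Measure.smul_apply, smul_eq_mul] at h1
      have h3 : ENNReal.ofReal c⁻¹ * n E ≤ 0 :=
        (ENNReal.add_le_add_iff_left (measure_ne_top m E)).1 (by simpa using h1)
      have h4 : ENNReal.ofReal c⁻¹ ≠ 0 := (ENNReal.ofReal_pos.2 (inv_pos.2 hc0)).ne'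
      exact (mul_eq_zero.1 (le_zero_iff.1 h3)).resolve_left h4
    rw [ofMeasure_apply n hE, Measure.real, h2, ENNReal.toReal_zero]

end Charge

/-! ### An invariant measure dominating all invariant probabilities. -/

section

variable {X : Type*} [MeasurableSpace X]

open Charge in
/-- If all invariant charges are countably additive, then setwise limits along an ultrafilter of
asymptotically invariant probability measures are invariant probability measures. -/
theorem exists_invariant_measure_tendsto {κ : Kernel X X} [IsMarkovKernel κ]
    (hca : ∀ μ ∈ invariantCharges κ, μ.IsCountablyAdditive)
    (m : ℕ → Measure X) [∀ n, IsProbabilityMeasure (m n)]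
    (hinv : ∀ E, MeasurableSet E →
      Tendsto (fun n => ((m n).bind κ).real E - (m n).real E) (hyperfilter ℕ) (𝓝 0)) :
    ∃ P : Measure X, IsProbabilityMeasure P ∧ P.bind κ = P ∧
      ∀ E, MeasurableSet E → Tendsto (fun n => (m n).real E) (hyperfilter ℕ) (𝓝 (P.real E)) := by
  obtain ⟨μ, hμ, hlim⟩ := exists_tendsto_hyperfilter m
  have hμinv := markovOperator_eq_of_tendsto κ hlim hinv
  obtain ⟨P, _, rfl⟩ := exists_eq_ofMeasure hμ.1 (hca μ ⟨hμ, hμinv⟩)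
  have huniv : P.real Set.univ = 1 := by rw [← ofMeasure_apply P MeasurableSet.univ]; exact hμ.2
  refine ⟨P, ⟨?_⟩, ?_, fun E hE => ofMeasure_apply P hE ▸ hlim E hE⟩
  · rw [← ENNReal.toReal_eq_one_iff]; exact huniv
  · rw [markovOperator_ofMeasure] at hμinv
    ext E hE
    have h := congrArg (fun ν : Charge X => ν E) hμinv
    simp only [ofMeasure_apply _ hE, Measure.real] at h
    exact (ENNReal.toReal_eq_toReal_iff' (measure_ne_top _ _) (measure_ne_top _ _)).1 h

/-- The part of an invariant measure that is singular to an invariant measure is invariant. -/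
theorem bind_restrict_eq_of_absolutelyContinuous {κ : Kernel X X} [IsMarkovKernel κ]
    {φ μ : Measure X} [IsFiniteMeasure μ] (hφ : φ.bind κ = φ) (hμ : μ.bind κ = μ) {S : Set X}
    (hS : MeasurableSet S) (hφS : φ S = 0) (hac : μ.restrict Sᶜ ≪ φ) :
    (μ.restrict S).bind κ = μ.restrict S := by
  have hsplit : μ.restrict S + μ.restrict Sᶜ = μ := Measure.restrict_add_restrict_compl hS
  have hsplit' : (μ.restrict S).bind κ + (μ.restrict Sᶜ).bind κ = μ := by
    rw [← Measure.comp_add, hsplit, hμ]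
  have hac' : (μ.restrict Sᶜ).bind κ ≪ φ := by
    have := Measure.AbsolutelyContinuous.comp_right hac κ
    rwa [hφ] at this
  -- Starting from `Sᶜ`, the chain puts no mass on the `φ`-null set `S`. Hence the image is at most
  -- `μ` restricted to `Sᶜ`, and it has the same total mass.
  have hc : (μ.restrict Sᶜ).bind κ = μ.restrict Sᶜ := by
    refine Measure.eq_of_le_of_measure_univ_eq (Measure.le_iff.2 fun E hE => ?_)
      (by simp [Measure.bind_apply MeasurableSet.univ κ.aemeasurable])
    calc (μ.restrict Sᶜ).bind κ E
        ≤ (μ.restrict Sᶜ).bind κ (E ∩ Sᶜ) + (μ.restrict Sᶜ).bind κ S := by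
          refine (measure_mono ?_).trans (measure_union_le _ _)
          intro x hx
          by_cases hxS : x ∈ S
          · exact Or.inr hxS
          · exact Or.inl ⟨hx, hxS⟩
      _ = (μ.restrict Sᶜ).bind κ (E ∩ Sᶜ) := by rw [hac' hφS, add_zero]
      _ ≤ μ (E ∩ Sᶜ) := by
          conv_rhs => rw [← hsplit', Measure.add_apply]
          exact le_add_self
      _ = μ.restrict Sᶜ E := (Measure.restrict_apply hE).symm
  ext E hE
  have h1 := congrArg (fun ν : Measure X => ν E) (hsplit'.trans hsplit.symm)
  simp only [Measure.add_apply, hc] at h1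
  exact (ENNReal.add_left_inj (measure_ne_top _ _)).1 h1

/-- The measure sought is `μ` conditioned on a `φ`-null set `S` carrying its singular part with
respect to `φ`; `S` is not `μ`-null because `μ` is not dominated by `φ`. -/
theorem exists_invariant_mutuallySingular {κ : Kernel X X} [IsMarkovKernel κ]
    {φ μ : Measure X} [IsFiniteMeasure φ] [IsFiniteMeasure μ] (hφ : φ.bind κ = φ)
    (hμ : μ.bind κ = μ) (hac : ¬ μ ≪ φ) :
    ∃ ν : Measure X, IsProbabilityMeasure ν ∧ ν.bind κ = ν ∧ φ ⟂ₘ ν := by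
  have hsing := (Measure.mutuallySingular_singularPart μ φ).symm
  set S := hsing.nullSet
  have hS : MeasurableSet S := hsing.measurableSet_nullSet
  have hφS : φ S = 0 := hsing.measure_nullSet
  have hμS : μ.singularPart φ Sᶜ = 0 := hsing.measure_compl_nullSet
  have hdec := Measure.haveLebesgueDecomposition_add μ φ
  have hres : μ.restrict Sᶜ ≪ φ := by
    refine Measure.AbsolutelyContinuous.mk fun E hE h0 => ?_
    rw [Measure.restrict_apply hE, hdec, Measure.add_apply,
      measure_mono_null Set.inter_subset_right hμS, zero_add]
    exact withDensity_absolutelyContinuous _ _ (measure_mono_null Set.inter_subset_left h0)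
  have hpos : μ S ≠ 0 := fun h0 => hac <| by
    refine Measure.AbsolutelyContinuous.mk fun E hE hE0 => ?_
    rw [← Measure.restrict_add_restrict_compl (μ := μ) hS, Measure.add_apply, hres hE0, add_zero,
      Measure.restrict_apply hE]
    exact measure_mono_null Set.inter_subset_right h0
  refine ⟨cond μ S, cond_isProbabilityMeasure hpos, ?_, ?_⟩
  · rw [ProbabilityTheory.cond, Measure.comp_smul,
      bind_restrict_eq_of_absolutelyContinuous hφ hμ hS hφS hres]
  · refine ⟨S, hS, hφS, ?_⟩
    rw [ProbabilityTheory.cond, Measure.smul_apply, Measure.restrict_apply hS.compl]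
    simp

/-- Otherwise finite sums of invariant probabilities never dominate, and singular parts build an
infinite mutually singular sequence. Its ultrafilter limit is null on each carrier but full on their
union, so it cannot be countably additive. -/
theorem exists_invariant_dominating {κ : Kernel X X} [IsMarkovKernel κ]
    (hca : ∀ μ ∈ invariantCharges κ, μ.IsCountablyAdditive) :
    ∃ φ : Measure X, IsFiniteMeasure φ ∧ φ.bind κ = φ ∧
      ∀ μ : Measure X, IsProbabilityMeasure μ → μ.bind κ = μ → μ ≪ φ := by
  by_contra! hcon
  have : Std.Symm fun μ ν : Measure X => μ ⟂ₘ ν := ⟨fun _ _ h => h.symm⟩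
  obtain ⟨m, hm, hsing⟩ := exists_seq_of_forall_finset_exists'
    (fun μ : Measure X => IsProbabilityMeasure μ ∧ μ.bind κ = μ) (fun μ ν => μ ⟂ₘ ν)
    (fun s hs => by
      have hfin : IsFiniteMeasure (∑ μ ∈ s, μ) := by
        refine ⟨?_⟩
        rw [Measure.finsetSum_apply]
        refine ENNReal.sum_lt_top.2 fun μ hμ => ?_
        have := (hs μ hμ).1
        exact measure_lt_top _ _
      have hinv : (∑ μ ∈ s, μ).bind κ = ∑ μ ∈ s, μ := by
        ext E hE
        rw [Measure.bind_apply hE κ.aemeasurable, lintegral_finsetSum_measure,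
          Measure.finsetSum_apply]
        refine Finset.sum_congr rfl fun μ hμ => ?_
        rw [← Measure.bind_apply hE κ.aemeasurable, (hs μ hμ).2]
      obtain ⟨μ, hμ, hμinv, hac⟩ := hcon _ hfin hinv
      obtain ⟨ν, hν, hνinv, hs'⟩ := exists_invariant_mutuallySingular hinv hμinv hac
      refine ⟨ν, ⟨hν, hνinv⟩, fun μ hμ => hs'.mono_ac ?_ Measure.AbsolutelyContinuous.rfl⟩
      exact (Measure.le_iff.2 fun E _ => by
        rw [Measure.finsetSum_apply]
        exact Finset.single_le_sum (f := fun μ : Measure X => μ E) (fun _ _ => zero_le)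
          hμ).absolutelyContinuous)
  have := fun n => (hm n).1
  -- Singularity to the sum of all other members gives one carrier of `m n` that is null for all of
  -- them at once.
  have hex : ∀ n, ∃ S, MeasurableSet S ∧ m n Sᶜ = 0 ∧ ∀ k, k ≠ n → m k S = 0 := by
    intro n
    have h : m n ⟂ₘ Measure.sum (fun k : {k // k ≠ n} => m k) :=
      Measure.MutuallySingular.sum_right.2 fun k => hsing k.2.symm
    refine ⟨h.nullSetᶜ, h.measurableSet_nullSet.compl, by simp, fun k hk => ?_⟩
    have h2 := h.measure_compl_nullSet
    rw [Measure.sum_apply _ h.measurableSet_nullSet.compl, ENNReal.tsum_eq_zero] at h2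
    exact h2 ⟨k, hk⟩
  choose S hS hSc hS0 using hex
  obtain ⟨P, hP, -, hlim⟩ := exists_invariant_measure_tendsto hca m fun E _ => by
    simp only [(hm _).2, sub_self]
    exact tendsto_const_nhds
  have h0 : ∀ n, P (S n) = 0 := by
    intro n
    rw [← measureReal_eq_zero_iff]
    refine tendsto_nhds_unique (hlim _ (hS n)) (tendsto_const_nhds.congr' ?_)
    -- The ultrafilter is free, so the single index charging `S n` does not count.
    have hne : {n}ᶜ ∈ hyperfilter ℕ := compl_mem_hyperfilter_of_finite (Set.finite_singleton n)
    filter_upwards [hne] with k hk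
    rw [Measure.real, hS0 n k hk, ENNReal.toReal_zero]
  have h1 : P.real (⋃ n, S n) = 1 := by
    refine tendsto_nhds_unique (hlim _ (MeasurableSet.iUnion hS))
      (tendsto_const_nhds.congr fun k => ?_)
    refine le_antisymm ?_ measureReal_le_one
    have h2 : (m k).real (S k) = 1 := by
      rw [Measure.real, (prob_compl_eq_zero_iff (hS k)).1 (hSc k), ENNReal.toReal_one]
    rw [← h2]
    exact measureReal_mono (Set.subset_iUnion S k)
  rw [Measure.real, measure_iUnion_null h0] at h1
  simp at h1

/-! ### Cesàro means, likely hitting sets and Doeblin's condition. -/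

/-- The average of the distributions of the chain started at `x` over the first `n + 1` steps. -/
noncomputable def cesaroMean (κ : Kernel X X) (n : ℕ) (x : X) : Measure X :=
  ((n : ENNReal) + 1)⁻¹ • ∑ i ∈ Finset.range (n + 1), (κ ^ i) x

theorem cesaroMean_real_apply (κ : Kernel X X) [IsMarkovKernel κ] (n : ℕ) (x : X) (E : Set X) :
    (cesaroMean κ n x).real E
      = ((n : ℝ) + 1)⁻¹ * ∑ i ∈ Finset.range (n + 1), ((κ ^ i) x).real E := by
  have := Charge.isMarkovKernel_pow κ
  rw [cesaroMean, measureReal_ennreal_smul_apply, ENNReal.toReal_inv, Measure.real,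
    Measure.finsetSum_apply, ENNReal.toReal_sum fun i _ => measure_ne_top _ _]
  congr 2

instance (κ : Kernel X X) [IsMarkovKernel κ] (n : ℕ) (x : X) :
    IsProbabilityMeasure (cesaroMean κ n x) := by
  have := Charge.isMarkovKernel_pow κ
  refine ⟨?_⟩
  rw [cesaroMean, Measure.smul_apply, Measure.finsetSum_apply]
  simp only [measure_univ, Finset.sum_const, Finset.card_range, nsmul_eq_mul, mul_one, smul_eq_mul,
    Nat.cast_add, Nat.cast_one]
  exact ENNReal.inv_mul_cancel (by simp) (by simp)

/-- The difference telescopes to the first and last terms, both in `[0, 1]`. -/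
theorem abs_bind_cesaroMean_sub_le (κ : Kernel X X) [IsMarkovKernel κ] (n : ℕ) (x : X) {E : Set X}
    (hE : MeasurableSet E) :
    |((cesaroMean κ n x).bind κ).real E - (cesaroMean κ n x).real E| ≤ ((n : ℝ) + 1)⁻¹ := by
  have := Charge.isMarkovKernel_pow κ
  have hb : ((cesaroMean κ n x).bind κ).real E
      = ((n : ℝ) + 1)⁻¹ * ∑ i ∈ Finset.range (n + 1), ((κ ^ (i + 1)) x).real E := by
    rw [Measure.real, cesaroMean, Measure.bind_apply hE κ.aemeasurable, lintegral_smul_measure,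
      lintegral_finsetSum_measure]
    simp only [← Kernel.pow_succ_apply_eq_lintegral κ _ x hE]
    rw [smul_eq_mul, ENNReal.toReal_mul, ENNReal.toReal_inv,
      ENNReal.toReal_sum fun i _ => measure_ne_top _ _]
    congr 2
  rw [hb, cesaroMean_real_apply, ← mul_sub, ← Finset.sum_sub_distrib,
    Finset.sum_range_sub (fun i => ((κ ^ i) x).real E), abs_mul, abs_of_nonneg (by positivity)]
  refine mul_le_of_le_one_right (by positivity) ?_
  have h1 : ((κ ^ (n + 1)) x).real E ≤ 1 := measureReal_le_one
  have h2 : ((κ ^ 0) x).real E ≤ 1 := measureReal_le_one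
  have h3 : 0 ≤ ((κ ^ (n + 1)) x).real E := measureReal_nonneg
  have h4 : 0 ≤ ((κ ^ 0) x).real E := measureReal_nonneg
  rw [abs_le]
  constructor <;> linarith

theorem bind_pow_eq {κ : Kernel X X} {φ : Measure X} (hφ : φ.bind κ = φ) (j : ℕ) :
    φ.bind (κ ^ j : Kernel X X) = φ := by
  induction j with
  | zero => exact Measure.id_comp
  | succ j ih =>
    change φ.bind ((κ ^ j) ∘ₖ κ : Kernel X X) = φ
    rw [← Measure.comp_assoc, hφ, ih]

/-- The points from which `E` is reached in exactly `j ≤ n` steps with probability at least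
one half, for some `j`. -/
def likelyHitting (κ : Kernel X X) (n : ℕ) (E : Set X) : Set X :=
  ⋃ j ∈ Finset.range (n + 1), {y | 1 / 2 ≤ ((κ ^ j) y).real E}

theorem measurableSet_likelyHitting (κ : Kernel X X) [IsMarkovKernel κ] (n : ℕ) {E : Set X}
    (hE : MeasurableSet E) : MeasurableSet (likelyHitting κ n E) := by
  have := Charge.isMarkovKernel_pow κ
  exact Finset.measurableSet_biUnion _ fun j _ =>
    measurableSet_le measurable_const (Charge.measurable_kernel_real (κ ^ j) hE)

/-- For each `j`, Markov's inequality applied to `p^j(·, E)`, whose `φ`-integral is `φ E` by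
invariance. -/
theorem measureReal_likelyHitting_le {κ : Kernel X X} [IsMarkovKernel κ] {φ : Measure X}
    [IsFiniteMeasure φ] (hφ : φ.bind κ = φ) (n : ℕ) {E : Set X} (hE : MeasurableSet E) :
    φ.real (likelyHitting κ n E) ≤ (n + 1) * (2 * φ.real E) := by
  have := Charge.isMarkovKernel_pow κ
  have h : ∀ j ∈ Finset.range (n + 1), φ.real {y | 1 / 2 ≤ ((κ ^ j) y).real E} ≤ 2 * φ.real E := by
    intro j _
    have h1 := mul_meas_ge_le_integral_of_nonneg (μ := φ)
      (ae_of_all _ fun y => measureReal_nonneg (μ := (κ ^ j) y) (s := E))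
      (Charge.integrable_of_abs_le (Charge.measurable_kernel_real (κ ^ j) hE)
        (Charge.abs_kernel_real_le (κ ^ j) E)) (1 / 2)
    rw [← Charge.real_bind_apply (κ ^ j) φ hE, bind_pow_eq hφ] at h1
    linarith
  refine (measureReal_biUnion_finset_le _ _).trans ((Finset.sum_le_sum h).trans (le_of_eq ?_))
  simp

/-- Condition on the state at time `i`. Outside the hitting set, `E` is reached in the remaining `n
- i` steps with probability below `1 / 2`, so `1 - η ≤ 1 / 2 + p^i(x, G) / 2`. -/
theorem le_measureReal_likelyHitting (κ : Kernel X X) [IsMarkovKernel κ] {n : ℕ} {E : Set X}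
    (hE : MeasurableSet E) {x : X} {η : ℝ} (hx : 1 - η ≤ ((κ ^ n) x).real E) {i : ℕ}
    (hi : i ≤ n) : 1 - 2 * η ≤ ((κ ^ i) x).real (likelyHitting κ n E) := by
  have := Charge.isMarkovKernel_pow κ
  set G := likelyHitting κ n E
  have hG : MeasurableSet G := measurableSet_likelyHitting κ n hE
  have h1 : ((κ ^ n) x).real E = ∫ y, ((κ ^ (n - i)) y).real E ∂((κ ^ i) x) := by
    rw [← Charge.real_bind_apply (κ ^ (n - i)) _ hE, ← Kernel.comp_apply, ← Kernel.pow_add,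
      Nat.sub_add_cancel hi]
  have h2 : ∫ y, ((κ ^ (n - i)) y).real E ∂((κ ^ i) x)
      ≤ ∫ y, (1 / 2 + G.indicator (fun _ => (1 / 2 : ℝ)) y) ∂((κ ^ i) x) := by
    refine integral_mono (Charge.integrable_of_abs_le (Charge.measurable_kernel_real _ hE)
      (Charge.abs_kernel_real_le _ E))
      ((integrable_const _).add ((integrable_const _).indicator hG)) fun y => ?_
    by_cases hy : y ∈ G
    · simp only [Set.indicator_of_mem hy]
      have : ((κ ^ (n - i)) y).real E ≤ 1 := measureReal_le_one
      linarith
    · simp only [Set.indicator_of_notMem hy, add_zero]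
      refine le_of_not_ge fun hle => hy ?_
      simp only [G, likelyHitting, Set.mem_iUnion]
      exact ⟨n - i, by simp, hle⟩
  rw [integral_add (integrable_const _) ((integrable_const _).indicator hG),
    integral_indicator_const _ hG] at h2
  simp only [integral_const, probReal_univ, smul_eq_mul] at h2
  linarith

theorem le_cesaroMean_likelyHitting (κ : Kernel X X) [IsMarkovKernel κ] {n : ℕ} {E : Set X}
    (hE : MeasurableSet E) {x : X} {η : ℝ} (hx : 1 - η ≤ ((κ ^ n) x).real E) :
    1 - 2 * η ≤ (cesaroMean κ n x).real (likelyHitting κ n E) := by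
  rw [cesaroMean_real_apply, inv_mul_eq_div, le_div_iff₀ (by positivity)]
  have := Finset.card_nsmul_le_sum (Finset.range (n + 1))
    (fun i => ((κ ^ i) x).real (likelyHitting κ n E)) (1 - 2 * η) fun i hi =>
      le_measureReal_likelyHitting κ hE hx (Nat.lt_succ_iff.1 (Finset.mem_range.1 hi))
  rw [Finset.card_range, nsmul_eq_mul] at this
  push_cast at this
  linarith

theorem doeblinCondition_of_isCountablyAdditive {κ : Kernel X X} [IsMarkovKernel κ]
    (hca : ∀ μ ∈ invariantCharges κ, μ.IsCountablyAdditive) : DoeblinCondition κ := by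
  obtain ⟨φ, hfin, hφ, hdom⟩ := exists_invariant_dominating hca
  by_contra hD
  -- The divisor `k + 2` cancels the number of times `0, …, k + 1` in the bound on `φ (G k)`, which
  -- leaves a summable geometric term. The time is `k + 1` because `(D)` asks for at least one step.
  have hex : ∀ k : ℕ, ∃ E, MeasurableSet E ∧ φ.real E ≤ (1 / 2) ^ k / (k + 2) ∧
      ∃ x, 1 - (1 / 2) ^ k / (k + 2) < ((κ ^ (k + 1)) x).real E := by
    intro k
    by_contra! hk
    exact hD ⟨φ, hfin, (1 / 2) ^ k / (k + 2), by positivity, k + 1, by omega, hk⟩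
  choose E hE hφE x hx using hex
  set G := fun k => likelyHitting κ (k + 1) (E k)
  have hG : ∀ k, MeasurableSet (G k) := fun k => measurableSet_likelyHitting κ _ (hE k)
  have hη : ∀ k : ℕ, (1 / 2 : ℝ) ^ k / (k + 2) ≤ (1 / 2) ^ k := fun k =>
    div_le_self (by positivity) (by linarith [(Nat.cast_nonneg k : (0 : ℝ) ≤ k)])
  have hφG : ∀ k, φ.real (G k) ≤ 2 * (1 / 2) ^ k := by
    intro k
    refine (measureReal_likelyHitting_le hφ (k + 1) (hE k)).trans ?_
    have h1 : ((1 / 2 : ℝ) ^ k / (k + 2)) * (k + 2) = (1 / 2) ^ k := by field_simp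
    have h2 := mul_le_mul_of_nonneg_right (hφE k) (by positivity : (0 : ℝ) ≤ k + 2)
    push_cast
    nlinarith
  obtain ⟨P, hP, hPinv, hlim⟩ := exists_invariant_measure_tendsto hca
    (fun k => cesaroMean κ (k + 1) (x k)) fun F hF => by
      refine Tendsto.mono_left ?_ Nat.hyperfilter_le_atTop
      refine squeeze_zero_norm (fun k => abs_bind_cesaroMean_sub_le κ (k + 1) (x k) hF) ?_
      have := (tendsto_one_div_add_atTop_nhds_zero_nat (𝕜 := ℝ)).comp (tendsto_add_atTop_nat 1)
      simpa [Function.comp_def] using this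
  -- The tail union is one fixed set containing `G k` for all `k ≥ K`, so setwise convergence
  -- applies to it.
  have hPG : ∀ K, P.real (⋃ k ≥ K, G k) = 1 := by
    intro K
    have hm : MeasurableSet (⋃ k ≥ K, G k) :=
      MeasurableSet.iUnion fun k => MeasurableSet.iUnion fun _ => hG k
    refine le_antisymm measureReal_le_one ?_
    have h1 : Tendsto (fun k : ℕ => 1 - 2 * (1 / 2 : ℝ) ^ k) (hyperfilter ℕ) (𝓝 1) := by
      have := ((tendsto_pow_atTop_nhds_zero_of_lt_one (by norm_num : (0 : ℝ) ≤ 1 / 2)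
        (by norm_num)).const_mul 2).const_sub 1
      rw [mul_zero, sub_zero] at this
      exact this.mono_left Nat.hyperfilter_le_atTop
    refine le_of_tendsto_of_tendsto h1 (hlim _ hm) ?_
    have hK : ∀ᶠ k in (hyperfilter ℕ : Filter ℕ), K ≤ k :=
      Nat.hyperfilter_le_atTop (eventually_ge_atTop K)
    filter_upwards [hK] with k hk
    have h2 := le_cesaroMean_likelyHitting κ (hE k) (hx k).le
    have h3 : (cesaroMean κ (k + 1) (x k)).real (G k)
        ≤ (cesaroMean κ (k + 1) (x k)).real (⋃ k ≥ K, G k) :=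
      measureReal_mono (Set.subset_iUnion₂ (s := fun k (_ : k ≥ K) => G k) k hk) (measure_ne_top _ _)
    linarith [hη k]
  have hφlim : φ (limsup G atTop) = 0 := by
    refine measure_limsup_atTop_eq_zero (ne_top_of_le_ne_top ?_
      (ENNReal.tsum_le_tsum fun k => ?_) (b := ∑' k, ENNReal.ofReal (2 * (1 / 2) ^ k)))
    · exact ((summable_geometric_of_lt_one (by norm_num)
        (by norm_num)).mul_left 2).tsum_ofReal_ne_top
    · rw [← ofReal_measureReal]
      exact ENNReal.ofReal_le_ofReal (hφG k)
  have hPlim : P (limsup G atTop) = 0 := hdom P hP hPinv hφlim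
  -- Continuity from above of the measure `P` carries full mass from the tail unions to `limsup G`.
  have hanti : Antitone fun K => ⋃ k ≥ K, G k := fun a b hab =>
    Set.biUnion_subset_biUnion_left fun k hk => le_trans hab hk
  have hlimP := tendsto_measure_iInter_atTop (μ := P)
    (fun K => (MeasurableSet.iUnion fun k => MeasurableSet.iUnion fun _ => hG k).nullMeasurableSet)
    hanti ⟨0, measure_ne_top _ _⟩
  have hone : ∀ K, P (⋃ k ≥ K, G k) = 1 := fun K =>
    (ENNReal.toReal_eq_one_iff _).1 (hPG K)
  rw [show ⋂ K, ⋃ k ≥ K, G k = limsup G atTop by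
    rw [limsup_eq_iInf_iSup_of_nat]; rfl, hPlim] at hlimP
  simp only [Function.comp_def, hone] at hlimP
  exact one_ne_zero (tendsto_nhds_unique tendsto_const_nhds hlimP)

end

theorem theorem4p4 {X : Type*} [MeasurableSpace X] (κ : Kernel X X) [IsMarkovKernel κ] :
    (DoeblinCondition κ ↔ ∀ μ ∈ invariantCharges κ, μ.IsCountablyAdditive) ∧
    ((∀ μ ∈ invariantCharges κ, μ.IsCountablyAdditive) ↔
      ¬ ∃ μ ∈ invariantCharges κ, μ.IsNonnegPurelyFinitelyAdditive) := by
  have hca : (¬ ∃ μ ∈ invariantCharges κ, μ.IsNonnegPurelyFinitelyAdditive) →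
      ∀ μ ∈ invariantCharges κ, μ.IsCountablyAdditive := fun h μ hμ =>
    by_contra fun hμca => h (Charge.exists_isNonnegPurelyFinitelyAdditive hμ hμca)
  refine ⟨⟨fun hD => hca ?_, doeblinCondition_of_isCountablyAdditive⟩, fun h => ?_, hca⟩
  · rintro ⟨μ, hμ, hpfa⟩
    exact Charge.not_isNonnegPurelyFinitelyAdditive_of_doeblinCondition hD hμ hpfa
  · rintro ⟨μ, hμ, hpfa⟩
    exact Charge.not_isNonnegPurelyFinitelyAdditive_of_isCountablyAdditive hμ.1 (h μ hμ) hpfa
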